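/- \textbf{Proposition (CS-type inequality for representable EJAs).} All vector spaces and algebras are real and finite-dimensional. A Euclidean Jordan algebra (EJA) is a vector space $\mathbb{V}$ with a commutative bilinear product $\circ$ that has an identity element $e$, satisfies $x^2\circ(x\circ y)=x\circ(x^2\circ y)$ (where $x^2:=x\circ x$), and admits an inner product with $\langle x, y\circ z\rangle=\langle x\circ y, z\rangle$ for all $x,y,z$. A Jordan frame of $\mathbb{V}$ is a family of pairwise orthogonal ($q_i\circ q_j=0$ for $i\neq j$) primitive idempotents $q_1,\dots,q_r$ with $\sum_i q_i=e$; every $x\in\mathbb{V}$ has a spectral decomposition $x=\sum_{i=1}^r\lambda_i q_i$ with $\lambda_i\in\mathbb{R}$ and $(q_i)$ a Jordan frame. The $\lambda_i$ are the eigenvalues of $x$, $\operatorname{tr}(x):=\sum_i\lambda_i$, and if no $\lambda_i$ is zero then $x$ is called invertible, with inverse $x^{-1}:=\sum_i\lambda_i^{-1}q_i$. Let $L(x)y:=x\circ y$ and let $P(x):=2L(x)^2-L(x^2)$ be the quadratic representation. The cone of squares is $\mathcal{K}:=\{x^2:x\in\mathbb{V}\}$, and $y\succeq_{\mathcal{K}}x$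 means $y-x\in\mathcal{K}$. An EJA is simple if it is nonzero and its only ideals are $\{0\}$ and itself. A simple Euclidean Jordan associative (EAJ) system is a triple $(\mathbb{A},\mathbb{S},\mathbb{V})$ where (i) $\mathbb{A}$ is a unital associative algebra with a linear map $x\mapsto x'$ such that $x''=x$ and $(xy)'=y'x'$; (ii) $\mathbb{S}=\{x\in\mathbb{A}:x'=x\}$ with $x\circ y:=(xy+yx)/2$ is an EJA, and $\operatorname{tr}(xx')\ge 0$ for all $x\in\mathbb{A}$, where $\operatorname{tr}$ is the trace of $\mathbb{S}$; (iii) $\mathbb{V}$ is a linear subspace of $\mathbb{S}$ closed under $\circ$ such that $(\mathbb{V},\circ)$ is a simple EJA. An EJA is representable if it is isomorphic, as a Jordan algebra, to a direct sum $\mathbb{V}_1\oplus\dots\oplus\mathbb{V}_k$ ($k\ge1$, componentwise product) of the third components of simple EAJ systems $(\mathbb{A}_j,\mathbb{S}_j,\mathbb{V}_j)$, $j=1,\dots,k$. Let $\mathbb{V}$ be a representable EJA with cone of squares $\mathcal{K}$. Let $v_1,\dots,v_n\in\mathcal{K}$ and $\alpha_1,\dots,\alpha_n,\beta_1,\dots,\beta_n\in\mathbb{R}$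 be such that $\sum_{i=1}^n\alpha_i^2v_i\in\operatorname{int}\mathcal{K}$. Then $\sum_{i=1}^n\alpha_i^2v_i$ is invertible and $$\sum_{i=1}^n\beta_i^2v_i\;\succeq_{\mathcal{K}}\;P\Big(\sum_{i=1}^n\alpha_i\beta_iv_i\Big)\Big(\sum_{i=1}^n\alpha_i^2v_i\Big)^{-1}.$$ -/

import Mathlib

open scoped BigOperators

universe u w

noncomputable section

namespace EJA

section General

variable {V : Type u} [AddCommGroup V] [Module ℝ V]

/-- `m` is a Euclidean Jordan product on the real vector space `V`: it is commutative, satisfies the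
Jordan identity, has an identity element, and admits an associative inner product `B`.
(Finite-dimensionality of `V` is always a separate type-class assumption.) -/
structure IsEJA (m : V →ₗ[ℝ] V →ₗ[ℝ] V) : Prop where
  comm : ∀ x y, m x y = m y x
  jordan : ∀ x y, m (m x x) (m x y) = m x (m (m x x) y)
  exists_one : ∃ e, ∀ x, m x e = x ∧ m e x = x
  exists_inner : ∃ B : V →ₗ[ℝ] V →ₗ[ℝ] ℝ,
    (∀ x y, B x y = B y x) ∧ (∀ x, x ≠ 0 → 0 < B x x) ∧ ∀ x y z, B x (m y z) = B (m x y) z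

/-- `V` is nonzero and has no ideals besides `0` and `V`. -/
def IsSimple (m : V →ₗ[ℝ] V →ₗ[ℝ] V) : Prop :=
  (∃ x : V, x ≠ 0) ∧
    ∀ I : Submodule ℝ V, (∀ x ∈ I, ∀ y, m x y ∈ I ∧ m y x ∈ I) → I = ⊥ ∨ I = ⊤

/-- A primitive idempotent: a nonzero idempotent that is not a sum of two nonzero orthogonal
idempotents. -/
def IsPrimitiveIdempotent (m : V →ₗ[ℝ] V →ₗ[ℝ] V) (q : V) : Prop :=
  q ≠ 0 ∧ m q q = q ∧
    ∀ a b, m a a = a → m b b = b → m a b = 0 → q = a + b → a = 0 ∨ b = 0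

/-- A Jordan frame: a complete system of pairwise orthogonal primitive idempotents. -/
structure IsJordanFrame (m : V →ₗ[ℝ] V →ₗ[ℝ] V) {r : ℕ} (q : Fin r → V) : Prop where
  primitive : ∀ i, IsPrimitiveIdempotent m (q i)
  orthogonal : ∀ i j, i ≠ j → m (q i) (q j) = 0
  complete : ∀ x, m (∑ i, q i) x = x

/-- `x = ∑ i, lam i • q i` is a spectral decomposition of `x`: `q` is a Jordan frame, and the
`lam i` are the eigenvalues of `x`, with multiplicities. -/
structure IsSpectralDecomposition (m : V →ₗ[ℝ] V →ₗ[ℝ] V) (x : V) {r : ℕ}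
    (lam : Fin r → ℝ) (q : Fin r → V) : Prop where
  frame : IsJordanFrame m q
  eq_sum : x = ∑ i, lam i • q i

/-- A chosen spectral decomposition of `x` (number of terms, eigenvalues, Jordan frame).  In a
Euclidean Jordan algebra every `x` has one, and the eigenvalues, as well as the elements `f(x)`
below, do not depend on the choice; the default value is then never used. -/
def spectralData (m : V →ₗ[ℝ] V →ₗ[ℝ] V) (x : V) :
    Σ r : ℕ, (Fin r → ℝ) × (Fin r → V) :=
  open Classical in
  if h : ∃ d : Σ r : ℕ, (Fin r → ℝ) × (Fin r → V), IsSpectralDecomposition m x d.2.1 d.2.2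
  then h.choose else ⟨0, fun _ => 0, fun _ => 0⟩

/-- The trace: the sum of the eigenvalues. -/
def trace (m : V →ₗ[ℝ] V →ₗ[ℝ] V) (x : V) : ℝ :=
  ∑ i, (spectralData m x).2.1 i

/-- `f(x) = ∑ i, f (lam i) • q i`. -/
def spectralMap (m : V →ₗ[ℝ] V →ₗ[ℝ] V) (f : ℝ → ℝ) (x : V) : V :=
  ∑ i, f ((spectralData m x).2.1 i) • (spectralData m x).2.2 i

/-- `x` is invertible: it has no zero eigenvalue. -/
def IsInvertible (m : V →ₗ[ℝ] V →ₗ[ℝ] V) (x : V) : Prop :=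
  ∃ (r : ℕ) (lam : Fin r → ℝ) (q : Fin r → V),
    IsSpectralDecomposition m x lam q ∧ ∀ i, lam i ≠ 0

/-- The inverse `x⁻¹ = ∑ i, (lam i)⁻¹ • q i` (meaningful when `x` is invertible). -/
def inverse (m : V →ₗ[ℝ] V →ₗ[ℝ] V) (x : V) : V :=
  spectralMap m (fun t => t⁻¹) x

/-- The quadratic representation `P(x) = 2 L(x)² - L(x²)`, where `L(x) = m x`. -/
def quadRep (m : V →ₗ[ℝ] V →ₗ[ℝ] V) (x : V) : V →ₗ[ℝ] V :=
  (2 : ℝ) • (m x ∘ₗ m x) - m (m x x)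

/-- The cone of squares. -/
def coneOfSquares (m : V →ₗ[ℝ] V →ₗ[ℝ] V) : Set V :=
  {y | ∃ x, y = m x x}

/-- `ConeGE m y x` is the relation `y ⪰ x` induced by the cone of squares. -/
def ConeGE (m : V →ₗ[ℝ] V →ₗ[ℝ] V) (y x : V) : Prop :=
  y - x ∈ coneOfSquares m

/-- The restriction of a bilinear product to a linear subspace closed under it. -/
def restrict (m : V →ₗ[ℝ] V →ₗ[ℝ] V) (U : Submodule ℝ V)
    (hU : ∀ x ∈ U, ∀ y ∈ U, m x y ∈ U) : U →ₗ[ℝ] U →ₗ[ℝ] U :=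
  LinearMap.mk₂ ℝ (fun x y => ⟨m x y, hU x x.2 y y.2⟩)
    (fun _ _ _ => Subtype.ext (by simp)) (fun _ _ _ => Subtype.ext (by simp))
    (fun _ _ _ => Subtype.ext (by simp)) (fun _ _ _ => Subtype.ext (by simp))

end General

section Associative

variable (A : Type w) [Ring A] [Algebra ℝ A]

/-- The symmetrized product `x ∘ y = (xy + yx) / 2` of an associative algebra. -/
def symMul : A →ₗ[ℝ] A →ₗ[ℝ] A :=
  (1 / 2 : ℝ) • (LinearMap.mul ℝ A + (LinearMap.mul ℝ A).flip)

theorem symMul_apply (x y : A) : symMul A x y = (1 / 2 : ℝ) • (x * y + y * x) := rfl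

variable [StarRing A] [StarModule ℝ A]

theorem symMul_mem_symmetric (x : A) (hx : x ∈ selfAdjoint.submodule ℝ A) (y : A)
    (hy : y ∈ selfAdjoint.submodule ℝ A) : symMul A x y ∈ selfAdjoint.submodule ℝ A := by
  have hx' : star x = x := hx
  have hy' : star y = y := hy
  change star (symMul A x y) = symMul A x y
  rw [symMul_apply, star_smul, star_add, star_mul, star_mul, hx', hy', add_comm (y * x)]
  simp

/-- The product `∘` on the subspace `𝕊 = {x | x' = x}` of symmetric elements. -/
def symmetricMul : selfAdjoint.submodule ℝ A →ₗ[ℝ] selfAdjoint.submodule ℝ A →ₗ[ℝ]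
    selfAdjoint.submodule ℝ A :=
  restrict (symMul A) (selfAdjoint.submodule ℝ A) (symMul_mem_symmetric A)

/-- The element `x x'`, which is symmetric. -/
def mulStar (x : A) : selfAdjoint.submodule ℝ A :=
  ⟨x * star x, IsSelfAdjoint.mul_star_self x⟩

end Associative

/-- A simple Euclidean Jordan associative system `(A, 𝕊, V)`: `A` is a finite-dimensional unital
associative real algebra with a linear conjugation `star` (`x'' = x`, `(xy)' = y'x'`), `𝕊` is its
subspace of symmetric elements, which is a Euclidean Jordan algebra under `x ∘ y = (xy + yx) / 2`;
`tr (x x') ≥ 0` for all `x` in `A`; and `V` is a simple Euclidean Jordan subalgebra of `𝕊`, whose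
identity element need not be that of `𝕊`. -/
structure SimpleEAJSystem where
  A : Type w
  [ring : Ring A]
  [algebra : Algebra ℝ A]
  [finiteDimensional : FiniteDimensional ℝ A]
  [starRing : StarRing A]
  [starModule : StarModule ℝ A]
  symmetric_isEJA : IsEJA (symmetricMul A)
  trace_mul_star_nonneg : ∀ x : A, 0 ≤ trace (symmetricMul A) (mulStar A x)
  V : Submodule ℝ A
  V_le : V ≤ selfAdjoint.submodule ℝ A
  V_closed : ∀ x ∈ V, ∀ y ∈ V, symMul A x y ∈ V
  V_isEJA : IsEJA (restrict (symMul A) V V_closed)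
  V_simple : IsSimple (restrict (symMul A) V V_closed)

attribute [instance] SimpleEAJSystem.ring SimpleEAJSystem.algebra
  SimpleEAJSystem.finiteDimensional SimpleEAJSystem.starRing SimpleEAJSystem.starModule

/-- The Jordan product on the component `V` of a simple Euclidean Jordan associative system. -/
def SimpleEAJSystem.mulV (T : SimpleEAJSystem.{w}) : T.V →ₗ[ℝ] T.V →ₗ[ℝ] T.V :=
  restrict (symMul T.A) T.V T.V_closed

/-- `(V, m)` is representable: it is generated by (that is, isomorphic as a Jordan algebra to the
third component of) a Euclidean Jordan associative system, namely of a finite direct sum of simple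
systems; the direct sum carries the componentwise product. -/
def IsRepresentable {V : Type u} [AddCommGroup V] [Module ℝ V] (m : V →ₗ[ℝ] V →ₗ[ℝ] V) : Prop :=
  ∃ (k : ℕ) (_ : 0 < k) (T : Fin k → SimpleEAJSystem.{w}) (φ : V ≃ₗ[ℝ] ((i : Fin k) → (T i).V)),
    ∀ x y i, φ (m x y) i = (T i).mulV (φ x i) (φ y i)

end EJA

end

/-!
A representable algebra `V` sits as a Jordan subalgebra of symmetric elements in the product `A` of
the associative algebras of its simple systems (`IsRepresentable.exists_isJordanEmbedding`), and
there `P(x) y = x y x`.  Write `a`, `b`, `c` for the sums of `αᵢ² vᵢ`, `αᵢ βᵢ vᵢ`, `βᵢ² vᵢ`, put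
`d = a⁻¹`, and let `vᵢ = wᵢ²`.  Since `d a d = d`, completing the square gives
`c - b d b = ∑ yᵢ yᵢ'` with `yᵢ = (βᵢ - αᵢ b d) wᵢ` (`sum_sq_smul_sub_eq_sum_mul_star`).

It remains to see that an element `x` of `V` which is a sum of elements `y y'` of `A` is a square in
`V`.  Take a spectral decomposition of `x` in `V`; compressing by an idempotent `q` of its frame
gives `c q = ∑ (q y) (q y)'`, where `c` is the eigenvalue, and `0 ≤ c` has to be shown.  This is the
positivity property `HasPositiveSquares` of `A`.  It passes to products, and for a single system it
follows from the hypothesis on the trace (`hasPositiveSquares_of_trace_nonneg`): by the same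
compression, applied to a spectral decomposition of `y y'` in the algebra of symmetric elements, all
eigenvalues of `y y'` are nonnegative, so `y y'` has nonnegative inner product with the identity.
The trace only enters at multiples `c q` of an idempotent, where it has the sign of `c`; neither its
linearity nor the uniqueness of eigenvalues is needed.

The existence of spectral decompositions, for Euclidean Jordan algebras inside associative algebras,
is `IsJordanEmbedding.exists_spectralDecomposition`: a maximal commuting subspace containing `x` is
a commutative associative algebra with an associative inner product, and its multiplication
operators are simultaneously diagonalizable.
-/

namespace EJA

/-! ### Jordan homomorphisms into associative algebras -/

section Special

variable {V : Type u} [AddCommGroup V] [Module ℝ V] {m : V →ₗ[ℝ] V →ₗ[ℝ] V}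
  {A : Type w} [Ring A] [Algebra ℝ A]

theorem mul_eq_zero_of_isIdempotentElem {p q : A} (hp : IsIdempotentElem p)
    (h : p * q + q * p = 0) : p * q = 0 := by
  have h1 : p * q + p * q * p = 0 := by
    have := congrArg (p * ·) h
    simpa [mul_add, ← mul_assoc, hp.eq] using this
  have h2 : p * q * p + q * p = 0 := by
    have := congrArg (· * p) h
    simpa [add_mul, mul_assoc, hp.eq] using this
  have h3 : p * q = q * p := by
    rw [eq_neg_of_add_eq_zero_left h1, eq_neg_of_add_eq_zero_right h2]
  rw [← h3, ← two_smul ℝ] at h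
  exact (smul_eq_zero.1 h).resolve_left two_ne_zero

theorem mul_eq_self_of_isIdempotentElem {u x : A} (hu : IsIdempotentElem u)
    (h : u * x + x * u = (2 : ℝ) • x) : u * x = x ∧ x * u = x := by
  have h1 : u * x * u = u * x := by
    have := congrArg (u * ·) h
    simp only [mul_add, ← mul_assoc, hu.eq, two_smul] at this
    exact add_left_cancel this
  have h2 : u * x * u = x * u := by
    have := congrArg (· * u) h
    simp only [add_mul, mul_assoc, hu.eq, two_smul] at this
    rw [mul_assoc]
    exact add_right_cancel this
  have h3 : u * x = x * u := h1.symm.trans h2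
  have h4 : u * x = x := by
    rw [← h3, ← two_smul ℝ] at h
    exact smul_right_injective A (two_ne_zero (α := ℝ)) h
  exact ⟨h4, h3 ▸ h4⟩

theorem symMul_eq_mul_of_commute {x y : A} (h : Commute x y) : symMul A x y = x * y := by
  rw [symMul_apply, ← h.eq, ← two_smul ℝ, smul_smul]
  norm_num

/-- `ψ` embeds the algebra `(V, m)` as a Jordan subalgebra of the associative algebra `A`. -/
structure IsJordanEmbedding (m : V →ₗ[ℝ] V →ₗ[ℝ] V) (ψ : V →ₗ[ℝ] A) : Prop where
  injective : Function.Injective ψ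
  map_mul : ∀ x y, ψ (m x y) = symMul A (ψ x) (ψ y)

namespace IsJordanEmbedding

variable {ψ : V →ₗ[ℝ] A}

theorem map_mul_of_commute (hψ : IsJordanEmbedding m ψ) {x y : V} (h : Commute (ψ x) (ψ y)) :
    ψ (m x y) = ψ x * ψ y := by
  rw [hψ.map_mul, symMul_eq_mul_of_commute h]

theorem map_sq (hψ : IsJordanEmbedding m ψ) (x : V) : ψ (m x x) = ψ x * ψ x :=
  hψ.map_mul_of_commute (Commute.refl _)

theorem isIdempotentElem (hψ : IsJordanEmbedding m ψ) {q : V} (hq : m q q = q) :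
    IsIdempotentElem (ψ q) := by
  rw [IsIdempotentElem, ← hψ.map_sq, hq]

theorem mul_add_mul (hψ : IsJordanEmbedding m ψ) (x y : V) :
    ψ x * ψ y + ψ y * ψ x = (2 : ℝ) • ψ (m x y) := by
  rw [hψ.map_mul, symMul_apply, smul_smul]
  norm_num

theorem mul_eq_zero (hψ : IsJordanEmbedding m ψ) {p q : V} (hp : m p p = p) (h : m p q = 0) :
    ψ p * ψ q = 0 :=
  mul_eq_zero_of_isIdempotentElem (hψ.isIdempotentElem hp) (by rw [hψ.mul_add_mul, h]; simp)

theorem mul_eq_self (hψ : IsJordanEmbedding m ψ) {p x : V} (hp : m p p = p) (h : m p x = x) :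
    ψ p * ψ x = ψ x ∧ ψ x * ψ p = ψ x :=
  mul_eq_self_of_isIdempotentElem (hψ.isIdempotentElem hp) (by rw [hψ.mul_add_mul, h])

/-- In an associative envelope the quadratic representation is `y ↦ x y x`. -/
theorem map_quadRep (hψ : IsJordanEmbedding m ψ) (x y : V) :
    ψ (quadRep m x y) = ψ x * ψ y * ψ x := by
  simp only [quadRep, LinearMap.sub_apply, LinearMap.smul_apply, LinearMap.comp_apply, map_sub,
    map_smul, hψ.map_mul, symMul_apply, mul_add, add_mul, smul_add, mul_smul_comm, smul_mul_assoc,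
    ← mul_assoc]
  module

end IsJordanEmbedding

end Special

/-! ### Existence of spectral decompositions -/

/-- Simultaneous diagonalization of commuting operators which are symmetric for an inner product
given as a bilinear form: every vector is a finite sum of joint eigenvectors. -/
theorem exists_sum_joint_eigenvectors {C : Type*} [AddCommGroup C] [Module ℝ C]
    [FiniteDimensional ℝ C] (B : C →ₗ[ℝ] C →ₗ[ℝ] ℝ) (hB : ∀ x y, B x y = B y x)
    (hpos : ∀ x, x ≠ 0 → 0 < B x x) {ι : Type*} (T : ι → C →ₗ[ℝ] C)
    (hT : ∀ i x y, B (T i x) y = B x (T i y)) (hcomm : ∀ i j, Commute (T i) (T j)) (e : C) :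
    ∃ f : (ι → ℝ) →₀ C, (∀ γ i, T i (f γ) = γ i • f γ) ∧ ∑ γ ∈ f.support, f γ = e := by
  let core : InnerProductSpace.Core ℝ C :=
    { inner := fun x y => B x y
      conj_inner_symm := fun x y => by simp [hB y x]
      re_inner_nonneg := fun x => by
        rcases eq_or_ne x 0 with rfl | h
        · simp
        · simpa using (hpos x h).le
      add_left := fun x y z => by simp
      smul_left := fun x y r => by simp
      definite := fun x h => by
        by_contra hx
        exact (hpos x hx).ne' h }
  let _ : NormedAddCommGroup C := core.toNormedAddCommGroup
  let _ : InnerProductSpace ℝ C := InnerProductSpace.ofCore core.toCore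
  have htop := LinearMap.IsSymmetric.iSup_iInf_eq_top_of_commute (𝕜 := ℝ) (T := T)
    (fun i x y => hT i x y) (fun i j _ => hcomm i j)
  have he : e ∈ ⨆ χ : ι → ℝ, ⨅ i, Module.End.eigenspace (T i) (χ i) := htop ▸ Submodule.mem_top
  obtain ⟨f, hf, hsum⟩ := (Submodule.mem_iSup_iff_exists_finsupp _ _).1 he
  refine ⟨f, fun γ i => ?_, hsum⟩
  exact Module.End.mem_eigenspace_iff.1 ((Submodule.mem_iInf _).1 (hf γ) i)

section Spectral

variable {V : Type u} [AddCommGroup V] [Module ℝ V] [FiniteDimensional ℝ V]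
  {m : V →ₗ[ℝ] V →ₗ[ℝ] V} {A : Type w} [Ring A] [Algebra ℝ A] {ψ : V →ₗ[ℝ] A}

/-- Every `x` lies in a subspace which is maximal among those with commuting image in `A`:
whatever commutes with such a subspace belongs to it. -/
theorem exists_maximal_commuting_submodule (ψ : V →ₗ[ℝ] A) (x : V) :
    ∃ C : Submodule ℝ V, x ∈ C ∧ (∀ a ∈ C, ∀ b ∈ C, Commute (ψ a) (ψ b)) ∧
      ∀ a, (∀ b ∈ C, Commute (ψ a) (ψ b)) → a ∈ C := by
  let S : Set (Submodule ℝ V) := {C | x ∈ C ∧ ∀ a ∈ C, ∀ b ∈ C, Commute (ψ a) (ψ b)}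
  have hS : S.Nonempty := by
    refine ⟨Submodule.span ℝ {x}, Submodule.mem_span_singleton_self x, fun a ha b hb => ?_⟩
    obtain ⟨s, rfl⟩ := Submodule.mem_span_singleton.1 ha
    obtain ⟨t, rfl⟩ := Submodule.mem_span_singleton.1 hb
    rw [map_smul, map_smul]
    exact ((Commute.refl _).smul_left s).smul_right t
  obtain ⟨C, hC, hmax⟩ := (wellFounded_gt (α := Submodule ℝ V)).has_min S hS
  refine ⟨C, hC.1, hC.2, fun a ha => ?_⟩
  by_contra hnot
  refine hmax (C ⊔ Submodule.span ℝ {a}) ⟨Submodule.mem_sup_left hC.1, ?_⟩ ?_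
  · intro y hy z hz
    obtain ⟨c, hc, d, hd, rfl⟩ := Submodule.mem_sup.1 hy
    obtain ⟨c', hc', d', hd', rfl⟩ := Submodule.mem_sup.1 hz
    obtain ⟨s, rfl⟩ := Submodule.mem_span_singleton.1 hd
    obtain ⟨t, rfl⟩ := Submodule.mem_span_singleton.1 hd'
    simp only [map_add, map_smul]
    exact ((hC.2 c hc c' hc').add_right ((ha c hc).symm.smul_right t)).add_left
      (((ha c' hc').smul_left s).add_right (((Commute.refl _).smul_left s).smul_right t))
  · refine lt_of_le_of_ne le_sup_left fun h => hnot ?_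
    rw [h]
    exact Submodule.mem_sup_right (Submodule.mem_span_singleton_self a)

/-- The spectral theorem for a Euclidean Jordan algebra embedded in an associative algebra.  A
maximal commuting subspace containing `x` is a commutative associative algebra; the components of
the identity in the joint eigenspaces of its multiplication operators form a Jordan frame. -/
theorem IsJordanEmbedding.exists_spectralDecomposition (hψ : IsJordanEmbedding m ψ) (hm : IsEJA m)
    (x : V) : ∃ (r : ℕ) (lam : Fin r → ℝ) (q : Fin r → V), IsSpectralDecomposition m x lam q := by
  obtain ⟨e, he⟩ := hm.exists_one
  obtain ⟨B, hBsymm, hBpos, hBassoc⟩ := hm.exists_inner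
  obtain ⟨C, hxC, hcomm, hmax⟩ := exists_maximal_commuting_submodule ψ x
  have hmul : ∀ a ∈ C, ∀ b ∈ C, m a b ∈ C := fun a ha b hb => hmax _ fun c hc => by
    rw [hψ.map_mul_of_commute (hcomm a ha b hb)]
    exact (hcomm a ha c hc).mul_left (hcomm b hb c hc)
  -- the identity of `V` acts as a two-sided identity on the image of `V` in `A`
  have heC : e ∈ C := hmax _ fun c _ => by
    obtain ⟨h1, h2⟩ := hψ.mul_eq_self (he e).1 (he c).2
    exact h1.trans h2.symm
  let T : C → C →ₗ[ℝ] C := fun c => restrict m C hmul c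
  obtain ⟨f, hf, hsum⟩ := exists_sum_joint_eigenvectors (B.domRestrict₁₂ C C)
    (fun a b => hBsymm a b) (fun a ha => hBpos a (by simpa using ha)) T
    (fun c a b => by
      change B (m c a) b = B a (m c b)
      rw [hBassoc, hm.comm c a])
    (fun c d => by
      refine LinearMap.ext fun a => Subtype.ext (hψ.injective ?_)
      change ψ (m c (m d a)) = ψ (m d (m c a))
      rw [hψ.map_mul_of_commute (hcomm _ c.2 _ (hmul _ d.2 _ a.2)),
        hψ.map_mul_of_commute (hcomm _ d.2 _ a.2),
        hψ.map_mul_of_commute (hcomm _ d.2 _ (hmul _ c.2 _ a.2)),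
        hψ.map_mul_of_commute (hcomm _ c.2 _ a.2), ← mul_assoc, ← mul_assoc,
        (hcomm _ c.2 _ d.2).eq])
    ⟨e, heC⟩
  have hfe : ∀ (γ : C → ℝ) (c : C), m c (f γ) = γ c • (f γ : V) := fun γ c =>
    congrArg Subtype.val (hf γ c)
  have hsum' : ∑ γ ∈ f.support, (f γ : V) = e := by
    have := congrArg Subtype.val hsum
    simpa using this
  -- eigenvectors for distinct characters have product zero
  have horth : ∀ γ δ, γ ≠ δ → m (f γ) (f δ) = 0 := by
    intro γ δ hne
    obtain ⟨c, hc⟩ := Function.ne_iff.1 hne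
    have h1 : γ c * B (m (f γ) (f δ)) (m (f γ) (f δ)) =
        δ c * B (m (f γ) (f δ)) (m (f γ) (f δ)) := by
      have h3 : m c (m (f γ) (f δ)) = γ c • m (f γ) (f δ) := by
        apply hψ.injective
        rw [hψ.map_mul_of_commute (hcomm _ c.2 _ (hmul _ (f γ).2 _ (f δ).2)), map_smul,
          hψ.map_mul_of_commute (hcomm _ (f γ).2 _ (f δ).2), ← mul_assoc,
          ← hψ.map_mul_of_commute (hcomm _ c.2 _ (f γ).2), hfe, map_smul, smul_mul_assoc]
      have h4 : m c (m (f γ) (f δ)) = δ c • m (f γ) (f δ) := by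
        rw [hm.comm (f γ)]
        apply hψ.injective
        rw [hψ.map_mul_of_commute (hcomm _ c.2 _ (hmul _ (f δ).2 _ (f γ).2)), map_smul,
          hψ.map_mul_of_commute (hcomm _ (f δ).2 _ (f γ).2), ← mul_assoc,
          ← hψ.map_mul_of_commute (hcomm _ c.2 _ (f δ).2), hfe, map_smul, smul_mul_assoc]
      have h5 := congrArg (fun z => B z (m (f γ) (f δ))) (h3.symm.trans h4)
      simpa using h5
    by_contra h0
    exact hc (mul_right_cancel₀ (hBpos _ h0).ne' h1)
  have hidem : ∀ γ, m (f γ) (f γ) = f γ := by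
    intro γ
    by_cases hγ : γ ∈ f.support
    · conv_rhs => rw [← (he (f γ)).1, ← hsum', map_sum]
      exact (Finset.sum_eq_single γ (fun δ _ hne => horth γ δ hne.symm)
        fun h => absurd hγ h).symm
    · simp [Finsupp.notMem_support_iff.1 hγ]
  have hprim : ∀ γ ∈ f.support, IsPrimitiveIdempotent m (f γ : V) := by
    intro γ hγ
    refine ⟨by simpa using hγ, hidem γ, fun a b ha hb hab hq => ?_⟩
    have hqa : m (f γ) a = a := by
      rw [hq, map_add, LinearMap.add_apply, ha, hm.comm b a, hab, add_zero]
    obtain ⟨hl, hr⟩ := hψ.mul_eq_self (hidem γ) hqa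
    -- `a` commutes with `C`, since `C` acts on the range of `f γ` by scalars
    have haC : a ∈ C := hmax a fun c hc => by
      have h1 : ψ c * ψ (f γ) = γ ⟨c, hc⟩ • ψ (f γ) := by
        rw [← hψ.map_mul_of_commute (hcomm _ hc _ (f γ).2), ← map_smul]
        exact congrArg ψ (hfe γ ⟨c, hc⟩)
      have h2 : ψ (f γ) * ψ c = γ ⟨c, hc⟩ • ψ (f γ) := by
        rw [← h1]; exact (hcomm _ (f γ).2 _ hc).eq
      calc ψ a * ψ c = ψ a * ψ (f γ) * ψ c := by rw [hr]
        _ = γ ⟨c, hc⟩ • ψ a := by rw [mul_assoc, h2, mul_smul_comm, hr]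
        _ = ψ c * (ψ (f γ) * ψ a) := by rw [← mul_assoc, h1, smul_mul_assoc, hl]
        _ = ψ c * ψ a := by rw [hl]
    have has : a = γ ⟨a, haC⟩ • (f γ : V) := by
      rw [← hfe γ ⟨a, haC⟩, hm.comm]; exact hqa.symm
    have hs : γ ⟨a, haC⟩ • a = a := by
      conv_rhs => rw [← ha]
      conv_rhs => arg 2; rw [has]
      rw [map_smul, hm.comm, hqa]
    by_cases h0 : a = 0
    · exact Or.inl h0
    · right
      have h1 : γ ⟨a, haC⟩ = 1 := by
        have : (γ ⟨a, haC⟩ - 1) • a = 0 := by rw [sub_smul, hs, one_smul, sub_self]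
        exact sub_eq_zero.1 ((smul_eq_zero.1 this).resolve_right h0)
      rw [h1, one_smul] at has
      rw [← has] at hq
      exact left_eq_add.1 hq
  let E := f.support.equivFin.symm
  have hE : ∀ g : (C → ℝ) → V, ∑ i, g (E i) = ∑ γ ∈ f.support, g γ := fun g => by
    rw [Equiv.sum_comp E (fun γ => g γ), Finset.sum_coe_sort]
  refine ⟨f.support.card, fun i => (E i : C → ℝ) ⟨x, hxC⟩, fun i => f (E i), ⟨?_, ?_, ?_⟩, ?_⟩
  · exact fun i => hprim _ (E i).2
  · exact fun i j hij => horth _ _ fun h => hij (E.injective (Subtype.ext h))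
  · intro y
    rw [hE fun γ => (f γ : V), hsum', (he y).2]
  · rw [hE fun γ => γ ⟨x, hxC⟩ • (f γ : V)]
    conv_lhs => rw [← (he x).1, ← hsum', map_sum]
    exact Finset.sum_congr rfl fun γ _ => hfe γ ⟨x, hxC⟩

end Spectral

/-! ### Eigenvalues and the trace -/

section Eigenvalues

variable {V : Type u} [AddCommGroup V] [Module ℝ V] {m : V →ₗ[ℝ] V →ₗ[ℝ] V}

theorem IsSpectralDecomposition.mul_frame {x : V} {r : ℕ} {lam : Fin r → ℝ} {q : Fin r → V}
    (h : IsSpectralDecomposition m x lam q) (k : Fin r) : m x (q k) = lam k • q k := by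
  rw [h.eq_sum, map_sum, LinearMap.sum_apply, Finset.sum_eq_single k]
  · rw [map_smul, LinearMap.smul_apply, (h.frame.primitive k).2.1]
  · intro j _ hj
    rw [map_smul, LinearMap.smul_apply, h.frame.orthogonal j k hj, smul_zero]
  · exact fun hk => absurd (Finset.mem_univ k) hk

theorem spectralData_spec {x : V} (h : ∃ (r : ℕ) (lam : Fin r → ℝ) (q : Fin r → V),
    IsSpectralDecomposition m x lam q) :
    IsSpectralDecomposition m x (spectralData m x).2.1 (spectralData m x).2.2 := by
  have h' : ∃ d : Σ r : ℕ, (Fin r → ℝ) × (Fin r → V),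
      IsSpectralDecomposition m x d.2.1 d.2.2 := by
    obtain ⟨r, lam, q, hq⟩ := h
    exact ⟨⟨r, lam, q⟩, hq⟩
  rw [spectralData, dif_pos h']
  exact h'.choose_spec

/-- The eigenvalues of `c • p`, for `p` idempotent, are among `0` and `c`, so a nonnegative trace
forces `c` to be nonnegative; linearity of the trace is not needed for this. -/
theorem nonneg_of_trace_smul_nonneg {p : V} (hp : m p p = p) (hp0 : p ≠ 0) {c : ℝ}
    (hex : ∃ (r : ℕ) (lam : Fin r → ℝ) (q : Fin r → V), IsSpectralDecomposition m (c • p) lam q)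
    (htr : 0 ≤ trace m (c • p)) : 0 ≤ c := by
  have hd := spectralData_spec hex
  rw [trace] at htr
  generalize (spectralData m (c • p)).2.1 = lam at hd htr
  generalize (spectralData m (c • p)).2.2 = q at hd
  by_contra hc
  rw [not_le] at hc
  -- `c • p` satisfies `X ^ 2 = c X`, and hence so do its eigenvalues
  have hval : ∀ k, lam k = 0 ∨ lam k = c := by
    intro k
    have h1 : m (m (c • p) (c • p)) (q k) = (lam k * lam k) • q k := by
      conv_lhs => arg 1; arg 2; arg 2; rw [hd.eq_sum]
      have h2 : m (c • p) (∑ i, lam i • q i) = ∑ i, (lam i * lam i) • q i := by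
        rw [map_sum]
        exact Finset.sum_congr rfl fun i _ => by rw [map_smul, hd.mul_frame, smul_smul]
      rw [h2]
      exact (IsSpectralDecomposition.mk hd.frame rfl :
        IsSpectralDecomposition m _ (fun i => lam i * lam i) q).mul_frame k
    have h3 : m (m (c • p) (c • p)) (q k) = (c * lam k) • q k := by
      have : m (c • p) (c • p) = c • (c • p) := by
        simp only [map_smul, LinearMap.smul_apply, hp]
      rw [this, map_smul, LinearMap.smul_apply, hd.mul_frame, smul_smul]
    have h4 := smul_left_injective ℝ (hd.frame.primitive k).1 (h1.symm.trans h3)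
    by_cases h0 : lam k = 0
    · exact Or.inl h0
    · exact Or.inr (mul_right_cancel₀ h0 h4)
  have hle : ∀ k ∈ Finset.univ, lam k ≤ 0 := fun k _ => by
    rcases hval k with h | h <;> rw [h]
    exact hc.le
  have hz := (Finset.sum_eq_zero_iff_of_nonpos hle).1 (le_antisymm (Finset.sum_nonpos hle) htr)
  have h0 : c • p = 0 := by
    rw [hd.eq_sum]
    exact Finset.sum_eq_zero fun k hk => by rw [hz k hk, zero_smul]
  exact (smul_eq_zero.1 h0).elim hc.ne hp0

end Eigenvalues

section

variable {V : Type u} [AddCommGroup V] [Module ℝ V] {m : V →ₗ[ℝ] V →ₗ[ℝ] V}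
  {A : Type w} [Ring A] [Algebra ℝ A] {ψ : V →ₗ[ℝ] A} {x : V} {r : ℕ} {lam : Fin r → ℝ}
  {q : Fin r → V}

theorem IsJordanEmbedding.mul_frame (hψ : IsJordanEmbedding m ψ)
    (hd : IsSpectralDecomposition m x lam q) (k : Fin r) :
    ψ x * ψ (q k) = lam k • ψ (q k) := by
  rw [hd.eq_sum, map_sum, Finset.sum_mul, Finset.sum_eq_single k]
  · rw [map_smul, smul_mul_assoc, (hψ.isIdempotentElem (hd.frame.primitive k).2.1).eq]
  · intro j _ hj
    rw [map_smul, smul_mul_assoc, hψ.mul_eq_zero (hd.frame.primitive j).2.1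
      (hd.frame.orthogonal j k hj), smul_zero]
  · exact fun hk => absurd (Finset.mem_univ k) hk

theorem IsJordanEmbedding.mul_mul_frame (hψ : IsJordanEmbedding m ψ)
    (hd : IsSpectralDecomposition m x lam q) (k : Fin r) :
    ψ (q k) * ψ x * ψ (q k) = lam k • ψ (q k) := by
  rw [mul_assoc, hψ.mul_frame hd, mul_smul_comm,
    (hψ.isIdempotentElem (hd.frame.primitive k).2.1).eq]

/-- The chosen inverse `d` of an element `a` with nonzero eigenvalues satisfies `d a d = d` in
the associative envelope. -/
theorem IsJordanEmbedding.inverse_mul_mul_inverse (hψ : IsJordanEmbedding m ψ) {a : V}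
    (hd : IsSpectralDecomposition m a (spectralData m a).2.1 (spectralData m a).2.2)
    (h0 : ∀ k, (spectralData m a).2.1 k ≠ 0) :
    ψ (inverse m a) * ψ a * ψ (inverse m a) = ψ (inverse m a) := by
  rw [inverse, spectralMap]
  generalize (spectralData m a).2.1 = lam at hd h0
  generalize (spectralData m a).2.2 = q at hd
  have hinv : IsSpectralDecomposition m (∑ k, (lam k)⁻¹ • q k) (fun k => (lam k)⁻¹) q :=
    ⟨hd.frame, rfl⟩
  have hprod : ψ (∑ k, (lam k)⁻¹ • q k) * ψ a = ψ (∑ k, q k) := by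
    rw [congrArg ψ hd.eq_sum, map_sum ψ fun k => lam k • q k, map_sum ψ q, Finset.mul_sum]
    refine Finset.sum_congr rfl fun k _ => ?_
    rw [map_smul, mul_smul_comm, hψ.mul_frame hinv, smul_smul, mul_inv_cancel₀ (h0 k), one_smul]
  rw [hprod]
  exact (hψ.mul_eq_self (hd.frame.complete _) (hd.frame.complete _)).1

end

/-! ### Positivity of sums of hermitian squares -/

/-- A weak positivity of the conjugation of `A`: a real multiple `c • q` of a nonzero symmetric
idempotent can be a sum of elements `y y'` only if `c` is nonnegative. -/
def HasPositiveSquares (A : Type w) [Ring A] [Algebra ℝ A] [StarRing A] : Prop :=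
  ∀ (q : A) (c : ℝ) (n : ℕ) (y : Fin n → A), star q = q → q * q = q → q ≠ 0 →
    c • q = ∑ i, y i * star (y i) → 0 ≤ c

section Positivity

variable {A : Type w} [Ring A] [Algebra ℝ A] [StarRing A] [StarModule ℝ A]

variable (A) in
theorem isJordanEmbedding_symmetric :
    IsJordanEmbedding (symmetricMul A) (selfAdjoint.submodule ℝ A).subtype :=
  ⟨Subtype.val_injective, fun _ _ => rfl⟩

/-- The hypothesis on the trace gives positivity: compressing `y y'` by a member `q` of its frame
gives `(q y) (q y)' = c q`, whose trace shows `0 ≤ c`.  So every `y y'` has nonnegative inner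
product with the identity. -/
theorem hasPositiveSquares_of_trace_nonneg [FiniteDimensional ℝ A] (hS : IsEJA (symmetricMul A))
    (htr : ∀ x : A, 0 ≤ trace (symmetricMul A) (mulStar A x)) : HasPositiveSquares A := by
  have hψ := isJordanEmbedding_symmetric A
  obtain ⟨e, he⟩ := hS.exists_one
  obtain ⟨B, -, hBpos, hBassoc⟩ := hS.exists_inner
  have hBidem : ∀ p, symmetricMul A p p = p → B e p = B p p := fun p hp => by
    conv_lhs => rw [← hp, hBassoc, (he p).2]
  have hpos : ∀ y : A, 0 ≤ B e (mulStar A y) := by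
    intro y
    obtain ⟨r, lam, q, hd⟩ := hψ.exists_spectralDecomposition hS (mulStar A y)
    rw [hd.eq_sum, map_sum]
    refine Finset.sum_nonneg fun k _ => ?_
    have hidem := (hd.frame.primitive k).2.1
    have hq0 := (hd.frame.primitive k).1
    rw [map_smul, hBidem _ hidem]
    refine mul_nonneg ?_ (hBpos _ hq0).le
    refine nonneg_of_trace_smul_nonneg hidem hq0 (hψ.exists_spectralDecomposition hS _) ?_
    have hcomp : mulStar A ((q k : A) * y) = lam k • q k := by
      apply Subtype.ext
      have hstar : star (q k : A) = q k := (q k).2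
      change (q k : A) * y * star ((q k : A) * y) = lam k • (q k : A)
      rw [star_mul, hstar, mul_assoc, ← mul_assoc y, ← mul_assoc]
      exact hψ.mul_mul_frame hd k
    rw [← hcomp]
    exact htr _
  intro q c n y hstar hq hq0 hsum
  let p : selfAdjoint.submodule ℝ A := ⟨q, hstar⟩
  have hp : symmetricMul A p p = p := Subtype.ext <|
    (symMul_eq_mul_of_commute (Commute.refl q)).trans hq
  have hp0 : p ≠ 0 := fun h => hq0 (congrArg Subtype.val h)
  have hsum' : c • p = ∑ i, mulStar A (y i) := Subtype.ext <| by
    rw [Submodule.coe_sum]; exact hsum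
  have h1 : 0 ≤ c * B p p := by
    rw [← hBidem p hp, ← smul_eq_mul, ← map_smul, hsum', map_sum]
    exact Finset.sum_nonneg fun i _ => hpos _
  exact nonneg_of_mul_nonneg_left h1 (hBpos p hp0)

theorem HasPositiveSquares.pi {ι : Type} {A : ι → Type w} [∀ i, Ring (A i)]
    [∀ i, Algebra ℝ (A i)] [∀ i, StarRing (A i)] (h : ∀ i, HasPositiveSquares (A i)) :
    HasPositiveSquares (∀ i, A i) := by
  intro q c n y hstar hq hq0 hsum
  obtain ⟨j, hj⟩ := Function.ne_iff.1 hq0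
  refine h j (q j) c n (fun i => y i j) (congrFun hstar j) (congrFun hq j) hj ?_
  have := congrFun hsum j
  simpa using this

end Positivity

/-! ### The cone of squares -/

section Cone

variable {V : Type u} [AddCommGroup V] [Module ℝ V] {m : V →ₗ[ℝ] V →ₗ[ℝ] V}
  {A : Type w} [Ring A] [Algebra ℝ A] [StarRing A] {ψ : V →ₗ[ℝ] A}

/-- Compressing a sum of elements `y y'` by the symmetric idempotent `ψ q` gives the sum of the
`(q y) (q y)'`. -/
theorem IsJordanEmbedding.nonneg_of_mul_eq_smul (hψ : IsJordanEmbedding m ψ)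
    (hstar : ∀ x, star (ψ x) = ψ x) (hA : HasPositiveSquares A) {x q : V} {c : ℝ}
    (hq : m q q = q) (hq0 : q ≠ 0) (h : ψ q * ψ x * ψ q = c • ψ q) {n : ℕ} {y : Fin n → A}
    (hx : ψ x = ∑ i, y i * star (y i)) : 0 ≤ c := by
  refine hA (ψ q) c n (fun i => ψ q * y i) (hstar q) (hψ.isIdempotentElem hq)
    (fun h0 => hq0 (hψ.injective (h0.trans (map_zero ψ).symm))) ?_
  rw [← h, hx, Finset.mul_sum, Finset.sum_mul]
  exact Finset.sum_congr rfl fun i _ => by simp only [star_mul, hstar, mul_assoc]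

theorem IsSpectralDecomposition.mem_coneOfSquares {x : V} {r : ℕ} {lam : Fin r → ℝ}
    {q : Fin r → V} (hd : IsSpectralDecomposition m x lam q) (hlam : ∀ k, 0 ≤ lam k) :
    x ∈ coneOfSquares m := by
  refine ⟨∑ k, √(lam k) • q k, ?_⟩
  have hs : IsSpectralDecomposition m (∑ k, √(lam k) • q k) (fun k => √(lam k)) q :=
    ⟨hd.frame, rfl⟩
  conv_rhs => rw [map_sum]
  conv_lhs => rw [hd.eq_sum]
  refine Finset.sum_congr rfl fun k _ => ?_
  rw [map_smul, hs.mul_frame, smul_smul, Real.mul_self_sqrt (hlam k)]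

/-- Sums of elements `y y'` which belong to `V` are squares in `V`: their eigenvalues are
nonnegative, so a square root can be taken in the spectral decomposition. -/
theorem IsJordanEmbedding.mem_coneOfSquares [FiniteDimensional ℝ V] (hψ : IsJordanEmbedding m ψ)
    (hm : IsEJA m) (hstar : ∀ x, star (ψ x) = ψ x) (hA : HasPositiveSquares A) {x : V} {n : ℕ}
    {y : Fin n → A} (hx : ψ x = ∑ i, y i * star (y i)) : x ∈ coneOfSquares m := by
  obtain ⟨r, lam, q, hd⟩ := hψ.exists_spectralDecomposition hm x
  refine hd.mem_coneOfSquares fun k => ?_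
  exact hψ.nonneg_of_mul_eq_smul hstar hA (hd.frame.primitive k).2.1 (hd.frame.primitive k).1
    (hψ.mul_mul_frame hd k) hx

/-- If `a - t q` is still a square for some `t > 0`, compression by `q` bounds the eigenvalue of `a`
at `q` below by `t`. -/
theorem IsJordanEmbedding.eigenvalue_pos_of_mem_interior [TopologicalSpace V]
    [IsTopologicalAddGroup V] [ContinuousSMul ℝ V] (hψ : IsJordanEmbedding m ψ)
    (hstar : ∀ x, star (ψ x) = ψ x) (hA : HasPositiveSquares A) {a : V} {r : ℕ}
    {lam : Fin r → ℝ} {q : Fin r → V} (hd : IsSpectralDecomposition m a lam q)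
    (ha : a ∈ interior (coneOfSquares m)) (k : Fin r) : 0 < lam k := by
  have hcont : Continuous fun t : ℝ => a - t • q k := by fun_prop
  have hnhds : ∀ᶠ t : ℝ in nhds 0, a - t • q k ∈ coneOfSquares m :=
    hcont.continuousAt.eventually (by
      simpa using mem_interior_iff_mem_nhds.1 ha)
  obtain ⟨t, ht, s, hs⟩ : ∃ t : ℝ, 0 < t ∧ a - t • q k ∈ coneOfSquares m := by
    obtain ⟨t, h1, h2⟩ := ((hnhds.filter_mono nhdsWithin_le_nhds).and
      (self_mem_nhdsWithin (s := Set.Ioi (0 : ℝ)))).exists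
    exact ⟨t, h2, h1⟩
  have hidem := (hd.frame.primitive k).2.1
  have hsub : 0 ≤ lam k - t := by
    refine hψ.nonneg_of_mul_eq_smul hstar hA (x := a - t • q k) hidem (hd.frame.primitive k).1 ?_
      (n := 1) (y := fun _ => ψ s) ?_
    · rw [map_sub, mul_sub, sub_mul, hψ.mul_mul_frame hd, map_smul, mul_smul_comm, smul_mul_assoc,
        (hψ.isIdempotentElem hidem).eq, (hψ.isIdempotentElem hidem).eq, sub_smul]
    · rw [hs, hψ.map_sq, Fin.sum_univ_one, hstar]
  linarith

/-! ### The inequality -/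

/-- Completing the square: with `a = ∑ αᵢ² vᵢ`, `b = ∑ αᵢ βᵢ vᵢ`, `d a d = d` and `vᵢ = wᵢ²`, the
element `∑ βᵢ² vᵢ - b d b` is the sum of the `yᵢ yᵢ'` for `yᵢ = (βᵢ - αᵢ b d) wᵢ`. -/
theorem sum_sq_smul_sub_eq_sum_mul_star [StarModule ℝ A] {n : ℕ} (w v : Fin n → A)
    (α β : Fin n → ℝ)
    (b d : A) (hw : ∀ i, star (w i) = w i) (hv : ∀ i, v i = w i * w i) (hb : star b = b)
    (hd : star d = d) (hsum : b = ∑ i, (α i * β i) • v i)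
    (hdad : d * (∑ i, (α i) ^ 2 • v i) * d = d) :
    ∑ i, (β i) ^ 2 • v i - b * d * b =
      ∑ i, (β i • w i - α i • (b * d * w i)) * star (β i • w i - α i • (b * d * w i)) := by
  have hterm : ∀ i, (β i • w i - α i • (b * d * w i)) * star (β i • w i - α i • (b * d * w i)) =
      (β i) ^ 2 • v i - (α i * β i) • v i * (d * b) - b * d * ((α i * β i) • v i) +
        b * (d * ((α i) ^ 2 • v i) * d) * b := fun i => by
    simp only [star_sub, star_smul, star_mul, hw, hb, hd, star_trivial, hv, sub_mul, mul_sub,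
      smul_mul_assoc, mul_smul_comm, mul_assoc]
    module
  simp only [hterm, Finset.sum_add_distrib, Finset.sum_sub_distrib, ← Finset.mul_sum,
    ← Finset.sum_mul, ← hsum, hdad]
  noncomm_ring

end Cone

/-- The isomorphism onto the direct sum embeds a representable algebra in a product of the
associative algebras of its simple systems. -/
theorem IsRepresentable.exists_isJordanEmbedding {V : Type u} [AddCommGroup V] [Module ℝ V]
    {m : V →ₗ[ℝ] V →ₗ[ℝ] V} (h : IsRepresentable.{u, w} m) :
    ∃ (k : ℕ) (T : Fin k → SimpleEAJSystem.{w}) (ψ : V →ₗ[ℝ] (∀ i, (T i).A)),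
      IsJordanEmbedding m ψ ∧ ∀ x, star (ψ x) = ψ x := by
  obtain ⟨k, -, T, φ, hφ⟩ := h
  refine ⟨k, T, LinearMap.pi fun i => (T i).V.subtype ∘ₗ
      (LinearMap.proj i : (∀ i, (T i).V) →ₗ[ℝ] (T i).V) ∘ₗ φ.toLinearMap,
    ⟨fun x y hxy => φ.injective (funext fun i => Subtype.ext (congrFun hxy i)), fun x y => ?_⟩,
    fun x => funext fun i => (T i).V_le (φ x i).2⟩
  funext i
  exact congrArg Subtype.val (hφ x y i)

end EJA

theorem mainTheorem3 {V : Type u} [AddCommGroup V] [Module ℝ V] [FiniteDimensional ℝ V]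
    [TopologicalSpace V] [IsTopologicalAddGroup V] [ContinuousSMul ℝ V] [T2Space V]
    (m : V →ₗ[ℝ] V →ₗ[ℝ] V) (hm : EJA.IsEJA m) (hrep : EJA.IsRepresentable.{u, w} m)
    {n : ℕ} (v : Fin n → V) (hv : ∀ i, v i ∈ EJA.coneOfSquares m) (α β : Fin n → ℝ)
    (hα : ∑ i, (α i) ^ 2 • v i ∈ interior (EJA.coneOfSquares m)) :
    EJA.IsInvertible m (∑ i, (α i) ^ 2 • v i) ∧
      EJA.ConeGE m (∑ i, (β i) ^ 2 • v i)
        (EJA.quadRep m (∑ i, (α i * β i) • v i)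
          (EJA.inverse m (∑ i, (α i) ^ 2 • v i))) := by
  obtain ⟨k, T, ψ, hψ, hstar⟩ := hrep.exists_isJordanEmbedding
  have hA : EJA.HasPositiveSquares (∀ i, (T i).A) := .pi fun i =>
    EJA.hasPositiveSquares_of_trace_nonneg (T i).symmetric_isEJA (T i).trace_mul_star_nonneg
  have hd := EJA.spectralData_spec
    (hψ.exists_spectralDecomposition hm (∑ i, (α i) ^ 2 • v i))
  have h0 := fun j => (hψ.eigenvalue_pos_of_mem_interior hstar hA hd hα j).ne'
  refine ⟨⟨_, _, _, hd, h0⟩, ?_⟩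
  choose w hw using hv
  have hdad := hψ.inverse_mul_mul_inverse hd h0
  rw [map_sum ψ fun i => (α i) ^ 2 • v i, Finset.sum_congr rfl fun i _ => map_smul ψ _ _] at hdad
  have hsq := EJA.sum_sq_smul_sub_eq_sum_mul_star (fun i => ψ (w i)) (fun i => ψ (v i)) α β
    (ψ (∑ i, (α i * β i) • v i)) (ψ (EJA.inverse m (∑ i, (α i) ^ 2 • v i)))
    (fun i => hstar _) (fun i => by rw [← hψ.map_sq, ← hw i]) (hstar _) (hstar _)
    (by simp only [map_sum, map_smul]) hdad
  refine hψ.mem_coneOfSquares hm hstar hA (Eq.trans ?_ hsq)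
  rw [map_sub, hψ.map_quadRep, map_sum]
  simp only [map_smul]
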